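/- A \emph{lattice} is a discrete subgroup $L$ of a finite-dimensional real inner product space (not necessarily spanning it). A \emph{lattice homomorphism} $f:L\to M$ is a group homomorphism with $\|f(x)\|\le\|x\|$ for all $x\in L$; its kernel $\operatorname{Ker}(f)$ is the lattice $\{x\in L: f(x)=0\}$. The volume $\operatorname{vol}(L)$ is $|\det T|$, where $T$ is the operator on $\operatorname{span}(L)$ taking an orthonormal basis to a $\mathbb Z$-basis of $L$. Put $\rho(L)=\sum_{x\in L}e^{-\pi\|x\|^2}$, $\ell(L)=\ln\rho(L)$ and, for $f:L\to M$, $\operatorname{nul}(f)=\ell(\operatorname{Ker}f)$ and $\operatorname{rk}(f)=\ell(L)-\ell(\operatorname{Ker} f)$. For a chain complex of lattices $A:\ 0\xrightarrow{a_0}A_1\xrightarrow{a_1}A_2\xrightarrow{a_2}\cdots$ put $h^k_\bullet(A)=\operatorname{nul}(a_{k+1})-\operatorname{rk}(a_k)$ for $k\ge 0$. The tensor product $L\otimes M$ is the subgroup of $\operatorname{span}(L)\otimes\operatorname{span}(M)$ generated by the tensors $x\otimes y$ with $x\in L$, $y\in M$. For $n\ge 1$ let $P_n\subset\mathbb R^2$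 be the lattice generated by $(\frac1n,0)$ and $\bigl(0,\sqrt{\frac1{n^2}-\frac1{n^4}}\bigr)$, embed $\mathbb Z$ in $P_n$ by $1\mapsto\bigl(\frac1n,\sqrt{1-\frac1{n^2}}\bigr)$, and let $P_n/\mathbb Z$ be the orthogonal projection of $P_n$ to the orthogonal complement of the image of $\mathbb Z$. For a lattice $L$ let $R_{L,n}$ be the chain complex $$0\to P_n\otimes L\to (P_n/\mathbb Z)\otimes L\to 0\to 0\to\cdots,$$ and define $h^k(L)=\lim_{n\to\infty}h^k_\bullet(R_{L,n})$ for $k\ge 0$ and $\chi(L)=\sum_{k\ge 0}(-1)^kh^k(L)$. \textbf{Theorem.} For every lattice $L$, the series defining $\rho(L)$ converges, $\operatorname{vol}(L)>0$, the limits defining $h^k(L)$ exist for all $k\ge 0$, and $$h^0(L)=\ln\rho(L),\qquad h^1(L)=\ln\rho(L)+\ln\operatorname{vol}(L),\qquad h^k(L)=0\ \text{ for } k\ge 2,\qquad \chi(L)=-\ln\operatorname{vol}(L).$$ -/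

import Mathlib

open CategoryTheory Filter Topology TensorProduct

universe u v

noncomputable section

/-! ### Lattices -/

/-- A lattice: a discrete subgroup of a finite-dimensional real inner product space
(not assumed to span it). -/
structure EuclLat : Type (u + 1) where
  V : Type u
  [normedAddCommGroup : NormedAddCommGroup V]
  [innerProductSpace : InnerProductSpace ℝ V]
  [finiteDimensional : FiniteDimensional ℝ V]
  pts : Submodule ℤ V
  [discrete : DiscreteTopology pts]

namespace EuclLat

attribute [instance] normedAddCommGroup innerProductSpace finiteDimensional discrete

/-- The real span of the lattice. -/
abbrev span (L : EuclLat.{u}) : Submodule ℝ L.V := Submodule.span ℝ (L.pts : Set L.V)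

/-- The local dimension of the lattice. -/
abbrev dim (L : EuclLat.{u}) : ℕ := Module.finrank ℝ L.span

/-- A lattice point, seen as a vector of the span. -/
def incl (L : EuclLat.{u}) : L.pts →ₗ[ℤ] L.span where
  toFun x := ⟨x, Submodule.subset_span x.2⟩
  map_add' _ _ := rfl
  map_smul' _ _ := rfl

@[simp] lemma coe_incl (L : EuclLat.{u}) (x : L.pts) : (L.incl x : L.V) = x := rfl

/-- The lattice seen as a full lattice in its span. -/
def full (L : EuclLat.{u}) : Submodule ℤ L.span := ZLattice.comap ℝ L.pts L.span.subtype

instance (L : EuclLat.{u}) : DiscreteTopology L.full :=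
  ZLattice.comap_discreteTopology ℝ L.pts (by fun_prop) Subtype.val_injective

instance (L : EuclLat.{u}) : IsZLattice ℝ L.full :=
  ⟨Submodule.map_injective_of_injective L.span.subtype_injective (by simp [full])⟩

def fullEquiv (L : EuclLat.{u}) : L.full ≃ₗ[ℤ] L.pts :=
  Submodule.comapSubtypeEquivOfLe (p := L.pts) (q := L.span.restrictScalars ℤ)
    Submodule.subset_span

/-- A (chosen) `ℤ`-basis of the lattice. -/
def zbasis (L : EuclLat.{u}) : Module.Basis (Fin L.dim) ℤ L.pts :=
  (Module.finBasisOfFinrankEq ℤ L.full (ZLattice.rank ℝ L.full)).map L.fullEquiv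

/-- A `ℤ`-basis of a lattice is an `ℝ`-basis of its span. -/
def rbasisOf (L : EuclLat.{u}) {ι : Type*} (b : Module.Basis ι ℤ L.pts) : Module.Basis ι ℝ L.span :=
  (b.map L.fullEquiv.symm).ofZLatticeBasis ℝ L.full

lemma rbasisOf_apply (L : EuclLat.{u}) {ι : Type*} (b : Module.Basis ι ℤ L.pts) (i : ι) :
    L.rbasisOf b i = L.incl (b i) := by
  simp only [rbasisOf, Module.Basis.ofZLatticeBasis_apply, Module.Basis.map_apply]
  rfl

/-- The chosen `ℤ`-basis of the lattice, as an `ℝ`-basis of its span. -/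
def rbasis (L : EuclLat.{u}) : Module.Basis (Fin L.dim) ℝ L.span := L.rbasisOf L.zbasis

lemma rbasis_apply (L : EuclLat.{u}) (i : Fin L.dim) : L.rbasis i = L.incl (L.zbasis i) :=
  L.rbasisOf_apply _ i

/-- `T` is the operator on the span with `T (e i) = x i`, for an orthonormal basis `e` of the
span and a basis `x` of the lattice. -/
def volOp (L : EuclLat.{u}) (e : OrthonormalBasis (Fin L.dim) ℝ L.span)
    (x : Module.Basis (Fin L.dim) ℤ L.pts) : L.span →ₗ[ℝ] L.span :=
  e.toBasis.constr ℝ (fun i => L.incl (x i))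

/-- The volume of a lattice. -/
def vol (L : EuclLat.{u}) : ℝ :=
  |LinearMap.det (L.volOp (stdOrthonormalBasis ℝ L.span) L.zbasis)|

/-- The volume does not depend on the bases. -/
theorem vol_eq (L : EuclLat.{u}) (e : OrthonormalBasis (Fin L.dim) ℝ L.span)
    (x : Module.Basis (Fin L.dim) ℤ L.pts) : L.vol = |LinearMap.det (L.volOp e x)| := by
  have key : ∀ (e : OrthonormalBasis (Fin L.dim) ℝ L.span)
      (x : Module.Basis (Fin L.dim) ℤ L.pts),
      LinearMap.det (L.volOp e x) = e.toBasis.det (L.rbasisOf x) := by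
    intro e x
    rw [← LinearMap.det_toMatrix e.toBasis, Module.Basis.det_apply]
    congr 1
    ext i j
    simp [LinearMap.toMatrix_apply, volOp, Module.Basis.toMatrix_apply, rbasisOf_apply,
      Module.Basis.constr_apply_fintype]
  have step : ∀ (e e' : OrthonormalBasis (Fin L.dim) ℝ L.span)
      (v : Fin L.dim → L.span), |e.toBasis.det v| = |e'.toBasis.det v| := by
    intro e e' v
    rw [e.toBasis.det.eq_smul_basis_det e'.toBasis]
    have h := e.det_to_matrix_orthonormalBasis_real e'
    rw [AlternatingMap.smul_apply, smul_eq_mul, abs_mul]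
    have : |e.toBasis.det e'.toBasis| = 1 := by
      rcases h with h | h <;> simp [h]
    rw [this, one_mul]
  have hx : |(L.rbasisOf L.zbasis).det (L.rbasisOf x)| = 1 := by
    have h1 : (L.rbasisOf L.zbasis).det (L.rbasisOf x) = ((L.zbasis.det x : ℤ) : ℝ) := by
      rw [Module.Basis.det_apply, Module.Basis.det_apply, Int.cast_det]
      congr 1
      ext i j
      simp only [Module.Basis.toMatrix_apply, rbasisOf_apply, Matrix.map_apply]
      have : L.incl (x j) = ((L.fullEquiv.symm (x j) : L.full) : L.span) := rfl
      rw [this, rbasisOf, Module.Basis.ofZLatticeBasis_repr_apply]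
      simp
    rw [h1, ← Int.cast_abs, Int.isUnit_iff_abs_eq.1 (L.zbasis.isUnit_det x)]
    simp
  rw [vol, key, key, step _ e, e.toBasis.det.eq_smul_basis_det (L.rbasisOf L.zbasis)]
  rw [AlternatingMap.smul_apply, AlternatingMap.smul_apply, smul_eq_mul, smul_eq_mul, abs_mul,
    abs_mul, hx, Module.Basis.det_self, abs_one]

/-! ### The category of lattices -/

/-- A lattice homomorphism: a group homomorphism of norm at most one. -/
@[ext] structure Hom (L : EuclLat.{u}) (M : EuclLat.{v}) where
  map : L.pts →+ M.pts
  norm_map_le : ∀ x : L.pts, ‖(map x : M.V)‖ ≤ ‖(x : L.V)‖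

instance : Category EuclLat.{u} where
  Hom L M := Hom L M
  id L := ⟨AddMonoidHom.id _, fun _ => le_rfl⟩
  comp f g := ⟨g.map.comp f.map, fun x => (g.norm_map_le _).trans (f.norm_map_le x)⟩

@[simp] lemma id_map (L : EuclLat.{u}) (x : L.pts) : Hom.map (𝟙 L) x = x := rfl

@[simp] lemma comp_map {L M N : EuclLat.{u}} (f : L ⟶ M) (g : M ⟶ N) (x : L.pts) :
    Hom.map (f ≫ g) x = g.map (f.map x) := rfl

lemma hom_ext {L M : EuclLat.{u}} {f g : L ⟶ M} (h : ∀ x, f.map x = g.map x) : f = g :=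
  Hom.ext (AddMonoidHom.ext h)

instance (L M : EuclLat.{u}) : Zero (L ⟶ M) := ⟨⟨0, fun _ => by simp⟩⟩

@[simp] lemma zero_map {L M : EuclLat.{u}} (x : L.pts) : (0 : L ⟶ M).map x = 0 := rfl

instance : Limits.HasZeroMorphisms EuclLat.{u} where
  comp_zero _ _ := hom_ext fun _ => rfl
  zero_comp _ _ _ f := hom_ext fun _ => f.map.map_zero

/-- The zero lattice. -/
abbrev zeroLat : EuclLat.{u} where
  V := EuclideanSpace ℝ PEmpty.{u + 1}
  pts := ⊥

lemma isZero_zeroLat : Limits.IsZero zeroLat.{u} := by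
  rw [Limits.IsZero.iff_id_eq_zero]
  exact hom_ext fun x => Subsingleton.elim _ _

/-- The kernel of a lattice homomorphism. -/
abbrev Ker {L : EuclLat.{u}} {M : EuclLat.{v}} (f : Hom L M) : EuclLat.{u} where
  V := L.V
  pts := (LinearMap.ker f.map.toIntLinearMap).map L.pts.subtype
  discrete := DiscreteTopology.of_subset (s := (L.pts : Set L.V)) L.discrete
    (by rintro _ ⟨x, -, rfl⟩; exact x.2)

lemma mem_Ker {L : EuclLat.{u}} {M : EuclLat.{v}} (f : Hom L M) (x : L.V) :
    x ∈ (Ker f).pts ↔ ∃ h : x ∈ L.pts, f.map ⟨x, h⟩ = 0 := by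
  constructor
  · rintro ⟨y, hy, rfl⟩
    exact ⟨y.2, hy⟩
  · rintro ⟨h, hx⟩
    exact ⟨⟨x, h⟩, hx, rfl⟩

/-- The inclusion of the kernel. -/
def kerι {L M : EuclLat.{u}} (f : L ⟶ M) : Ker f ⟶ L where
  map := (Submodule.inclusion (show (Ker f).pts ≤ L.pts by
    rintro _ ⟨x, -, rfl⟩; exact x.2)).toAddMonoidHom
  norm_map_le _ := le_rfl

lemma kerι_comp {L M : EuclLat.{u}} (f : L ⟶ M) : kerι f ≫ f = 0 :=
  hom_ext fun x => ((mem_Ker f x).1 x.2).2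

/-- `Ker f` is a kernel of `f` in the category of lattices. -/
def kerIsLimit {L M : EuclLat.{u}} (f : L ⟶ M) :
    Limits.IsLimit (Limits.KernelFork.ofι (kerι f) (kerι_comp f)) :=
  Limits.KernelFork.IsLimit.ofι _ _
    (fun {N} g hg =>
      { map :=
          { toFun := fun x => ⟨g.map x, (mem_Ker f _).2 ⟨(g.map x).2,
              congrArg (fun k : N ⟶ M => k.map x) hg⟩⟩
            map_zero' := Subtype.ext (by simp)
            map_add' := fun x y => Subtype.ext (congrArg (fun t : L.pts => (t : L.V)) (g.map.map_add x y)) }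
        norm_map_le := g.norm_map_le })
    (fun _ _ => rfl)
    (fun _ _ m hm => hom_ext fun x =>
      Subtype.ext (congrArg (fun k => ((Hom.map k x : L.pts) : L.V)) hm))

/-! ### Linear extension of homomorphisms, tensor products -/

/-- The linear extension of a lattice homomorphism to the spans. -/
def Hom.real {L : EuclLat.{u}} {M : EuclLat.{v}} (f : Hom L M) : L.span →ₗ[ℝ] M.span :=
  L.rbasis.constr ℝ (fun i => M.incl (f.map (L.zbasis i)))

lemma Hom.real_incl {L : EuclLat.{u}} {M : EuclLat.{v}} (f : Hom L M) (x : L.pts) :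
    f.real (L.incl x) = M.incl (f.map x) := by
  have : (f.real.restrictScalars ℤ) ∘ₗ L.incl = M.incl ∘ₗ f.map.toIntLinearMap := by
    refine L.zbasis.ext fun i => ?_
    have := L.rbasis.constr_basis ℝ (fun i => M.incl (f.map (L.zbasis i))) i
    rw [rbasis_apply] at this
    simpa [Hom.real] using this
  exact LinearMap.congr_fun this x

lemma span_rbasis (L : EuclLat.{u}) :
    Submodule.span ℤ (Set.range L.rbasis) = LinearMap.range L.incl := by
  have : Set.range L.rbasis = L.incl '' Set.range L.zbasis := by
    rw [← Set.range_comp]; congr 1; ext1 i; exact L.rbasis_apply i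
  rw [this, Submodule.span_image, L.zbasis.span_eq, Submodule.map_top]

lemma Hom.norm_real_le {L : EuclLat.{u}} {M : EuclLat.{v}} (f : Hom L M) (x : L.span) :
    ‖f.real x‖ ≤ ‖x‖ := by
  set C := ∑ i, ‖L.rbasis i‖
  set F := LinearMap.toContinuousLinearMap f.real
  have h1 : ∀ y : L.span, ‖f.real y‖ ≤ ‖y‖ + (C + ‖F‖ * C) := by
    intro y
    have hfl : ((ZSpan.floor L.rbasis y : _) : L.span) ∈ LinearMap.range L.incl := by
      rw [← span_rbasis]; exact (ZSpan.floor L.rbasis y).2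
    obtain ⟨z, hz⟩ := hfl
    have hy : y = L.incl z + ZSpan.fract L.rbasis y := by
      rw [hz, ZSpan.fract_apply]; abel
    have hfr := ZSpan.norm_fract_le L.rbasis y
    set r := ZSpan.fract L.rbasis y
    have hFr : ‖f.real r‖ ≤ ‖F‖ * C :=
      (F.le_opNorm r).trans (mul_le_mul_of_nonneg_left hfr (norm_nonneg _))
    have hz1 : ‖f.real (L.incl z)‖ ≤ ‖L.incl z‖ := by
      rw [f.real_incl]; exact f.norm_map_le z
    have hz2 : ‖L.incl z‖ ≤ ‖y‖ + C := by
      have : L.incl z = y - r := by rw [hy]; abel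
      rw [this]
      exact (norm_sub_le _ _).trans (by gcongr)
    calc ‖f.real y‖ = ‖f.real (L.incl z) + f.real r‖ := by rw [← map_add, ← hy]
      _ ≤ ‖f.real (L.incl z)‖ + ‖f.real r‖ := norm_add_le _ _
      _ ≤ ‖y‖ + (C + ‖F‖ * C) := by linarith
  have h2 : ∀ n : ℕ, (n : ℝ) * (‖f.real x‖ - ‖x‖) ≤ C + ‖F‖ * C := by
    intro n
    have := h1 ((n : ℝ) • x)
    rw [map_smul, norm_smul, norm_smul, Real.norm_natCast] at this
    linarith
  by_contra! hlt
  obtain ⟨n, hn⟩ := exists_nat_gt ((C + ‖F‖ * C) / (‖f.real x‖ - ‖x‖))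
  rw [div_lt_iff₀ (sub_pos.2 hlt)] at hn
  exact absurd (h2 n) (not_le.2 hn)

lemma intCast_smul_mem {E : Type*} [NormedAddCommGroup E] [NormedSpace ℝ E]
    (S : Submodule ℤ E) (n : ℤ) {x : E} (hx : x ∈ S) : (n : ℝ) • x ∈ S := by
  rw [Int.cast_smul_eq_zsmul]
  exact S.smul_mem n hx

lemma discrete_of_le_span {E : Type*} [NormedAddCommGroup E] [NormedSpace ℝ E]
    [FiniteDimensional ℝ E] {ι : Type*} [Finite ι] (b : Module.Basis ι ℝ E) (S : Submodule ℤ E)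
    (h : S ≤ Submodule.span ℤ (Set.range b)) : DiscreteTopology S :=
  DiscreteTopology.of_subset (s := (Submodule.span ℤ (Set.range b) : Set E))
    (inferInstanceAs (DiscreteTopology (Submodule.span ℤ (Set.range b)))) h

/-- The tensor product of two lattices: the subgroup of the tensor product of the spans that is
generated by the pure tensors of lattice points. -/
abbrev tensor (L : EuclLat.{u}) (M : EuclLat.{v}) : EuclLat.{max u v} where
  V := L.span ⊗[ℝ] M.span
  pts := Submodule.span ℤ (Set.range fun p : L.pts × M.pts => L.incl p.1 ⊗ₜ[ℝ] M.incl p.2)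
  discrete := by
    refine discrete_of_le_span (L.rbasis.tensorProduct M.rbasis) _ (Submodule.span_le.2 ?_)
    rintro _ ⟨⟨x, y⟩, rfl⟩
    rw [SetLike.mem_coe]
    dsimp only
    rw [← L.zbasis.sum_repr x, ← M.zbasis.sum_repr y]
    simp only [map_sum, map_smul, TensorProduct.sum_tmul, TensorProduct.tmul_sum]
    refine Submodule.sum_mem _ fun j _ => Submodule.sum_mem _ fun i _ => ?_
    rw [← Int.cast_smul_eq_zsmul ℝ, ← Int.cast_smul_eq_zsmul ℝ, TensorProduct.smul_tmul_smul,
      ← Int.cast_mul, ← rbasis_apply, ← rbasis_apply, ← Module.Basis.tensorProduct_apply]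
    refine intCast_smul_mem (E := L.span ⊗[ℝ] M.span) _ _ ?_
    exact Submodule.subset_span (Set.mem_range_self _)

/-- The homomorphism `f ⊗ N` from `L ⊗ N` to `M ⊗ N`. -/
def tensorHom {L M : EuclLat.{u}} (f : Hom L M) (N : EuclLat.{v}) :
    Hom (tensor L N) (tensor M N) where
  map := (((f.real.rTensor N.span).restrictScalars ℤ).restrict (p := (tensor L N).pts)
    (q := (tensor M N).pts) (by
      have h : (tensor L N).pts ≤
          ((tensor M N).pts).comap ((f.real.rTensor N.span).restrictScalars ℤ) := by
        refine Submodule.span_le.2 ?_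
        rintro _ ⟨⟨x, y⟩, rfl⟩
        refine Submodule.subset_span ⟨(f.map x, y), ?_⟩
        simp [f.real_incl]
      exact h)).toAddMonoidHom
  norm_map_le x := by
    have h1 := ContinuousLinearMap.norm_rTensor_le (G := N.span)
      (LinearMap.toContinuousLinearMap f.real)
    have h2 : ‖LinearMap.toContinuousLinearMap f.real‖ ≤ 1 :=
      ContinuousLinearMap.opNorm_le_bound _ zero_le_one
        (fun x => by simpa using f.norm_real_le x)
    have h3 := ((LinearMap.toContinuousLinearMap f.real).rTensor N.span).le_of_opNorm_le
      (h1.trans h2) (x : L.span ⊗[ℝ] N.span)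
    rw [one_mul] at h3
    exact h3

/-! ### Quotient lattices -/

/-- `K` is (the underlying group of) a normal sublattice of `M`: the intersection of `M` with a
subspace of the span of `M`. -/
def IsNormal (M : EuclLat.{u}) (K : Submodule ℤ M.V) : Prop :=
  ∃ W : Submodule ℝ M.V, W ≤ M.span ∧ K = M.pts ⊓ W.restrictScalars ℤ

lemma IsNormal.le {M : EuclLat.{u}} {K : Submodule ℤ M.V} (hK : M.IsNormal K) : K ≤ M.pts := by
  obtain ⟨W, -, rfl⟩ := hK
  exact inf_le_left

/-- The orthogonal projection to the orthogonal complement of the span of `K`. -/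
def proj {V : Type u} [NormedAddCommGroup V] [InnerProductSpace ℝ V] [FiniteDimensional ℝ V]
    (K : Submodule ℤ V) : V →L[ℝ] V :=
  (Submodule.span ℝ (K : Set V))ᗮ.starProjection

lemma discrete_proj (M : EuclLat.{u}) (K : Submodule ℤ M.V) (hK : K ≤ M.pts) :
    DiscreteTopology (M.pts.map ((proj K).toLinearMap.restrictScalars ℤ)) := by
  have hdK : DiscreteTopology K := DiscreteTopology.of_subset (s := (M.pts : Set M.V)) M.discrete hK
  let N : EuclLat.{u} := { V := M.V, pts := K }
  set C := ∑ i, ‖N.rbasis i‖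
  set P := proj K with hP
  have hPK : ∀ y ∈ N.span, P y = 0 := by
    intro y hy
    rw [hP, proj, Submodule.starProjection_apply_eq_zero_iff, Submodule.orthogonal_orthogonal]
    exact hy
  have hlift : ∀ l ∈ M.pts, ∃ l' ∈ M.pts, P l' = P l ∧ ‖l'‖ ≤ ‖P l‖ + C := by
    intro l hl
    have hu : l - P l ∈ N.span := by
      have := Submodule.sub_starProjection_mem_orthogonal (K := (Submodule.span ℝ (K : Set M.V))ᗮ) l
      rwa [Submodule.orthogonal_orthogonal] at this
    have hfl : ((ZSpan.floor N.rbasis ⟨_, hu⟩ : _) : N.span) ∈ LinearMap.range N.incl := by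
      rw [← span_rbasis]; exact (ZSpan.floor N.rbasis _).2
    obtain ⟨z, hz⟩ := hfl
    have hfr := ZSpan.norm_fract_le N.rbasis ⟨_, hu⟩
    have hfe := ZSpan.fract_apply N.rbasis ⟨_, hu⟩
    rw [← hz] at hfe
    set r := ZSpan.fract N.rbasis ⟨_, hu⟩
    have hr : (r : M.V) = l - P l - z := by rw [hfe]; rfl
    refine ⟨l - z, M.pts.sub_mem hl (hK z.2), ?_, ?_⟩
    · rw [map_sub, hPK _ (Submodule.subset_span z.2), sub_zero]
    · have : l - (z : M.V) = P l + r := by rw [hr]; abel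
      rw [this]
      exact (norm_add_le _ _).trans (by gcongr; exact hfr)
  set S := M.pts.map (P.toLinearMap.restrictScalars ℤ)
  have hfin : (Metric.ball (0 : M.V) 1 ∩ S).Finite := by
    have hcl : IsClosed (M.pts : Set M.V) :=
      @AddSubgroup.isClosed_of_discrete _ _ _ _ _ M.pts.toAddSubgroup M.discrete
    have h0 : (Metric.closedBall (0 : M.V) (1 + C) ∩ (M.pts : Set M.V)).Finite :=
      Metric.finite_isBounded_inter_isClosed ⟨M.discrete⟩ Metric.isBounded_closedBall hcl
    refine (h0.image P).subset ?_
    rintro _ ⟨hb, l, hl, rfl⟩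
    obtain ⟨l', hl', h1, h2⟩ := hlift l hl
    refine ⟨l', ⟨?_, hl'⟩, h1⟩
    rw [mem_closedBall_zero_iff]
    have : ‖P l‖ < 1 := by simpa using hb
    linarith
  refine discreteTopology_of_isOpen_singleton_zero ?_
  refine ⟨Metric.ball 0 1 ∩ ((Metric.ball (0 : M.V) 1 ∩ S) \ {0})ᶜ,
    Metric.isOpen_ball.inter (hfin.subset Set.sdiff_subset).isClosed.isOpen_compl, ?_⟩
  ext x
  simp only [Set.mem_preimage, Set.mem_inter_iff, Set.mem_compl_iff, Set.mem_sdiff,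
    Set.mem_singleton_iff, not_and, not_not]
  constructor
  · rintro ⟨h1, h2⟩
    exact Subtype.ext (h2 ⟨h1, x.2⟩)
  · rintro rfl
    simp

/-- The quotient `M / K` of a lattice by a normal sublattice: the orthogonal projection of `M` to
the orthogonal complement of the span of `K`. -/
abbrev quot (M : EuclLat.{u}) (K : Submodule ℤ M.V) (hK : M.IsNormal K) : EuclLat.{u} where
  V := M.V
  pts := M.pts.map ((proj K).toLinearMap.restrictScalars ℤ)
  discrete := M.discrete_proj K hK.le

/-- The projection homomorphism from `M` to `M / K`. -/
def quotHom (M : EuclLat.{u}) (K : Submodule ℤ M.V) (hK : M.IsNormal K) : Hom M (M.quot K hK) where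
  map := (((proj K).toLinearMap.restrictScalars ℤ).restrict (p := M.pts)
    (q := (M.quot K hK).pts) (fun x hx => ⟨x, hx, rfl⟩)).toAddMonoidHom
  norm_map_le _ := Submodule.norm_starProjection_apply_le _ _

/-! ### The Gaussian mass, the rank, and the cohomology of chain complexes -/

/-- The Gaussian mass of a subset of an inner product space. -/
def rho {V : Type u} [NormedAddCommGroup V] [InnerProductSpace ℝ V] (S : Set V) : ℝ :=
  ∑' x : S, Real.exp (-Real.pi * ‖(x : V)‖ ^ 2)

/-- `ℓ(L) = ln ρ(L)`. -/
def ell (L : EuclLat.{u}) : ℝ := Real.log (rho (L.pts : Set L.V))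

/-- The nullity of a homomorphism. -/
def nul {L M : EuclLat.{u}} (f : L ⟶ M) : ℝ := ell (Ker f)

/-- The canonical rank of a homomorphism. -/
def rk {L M : EuclLat.{u}} (f : L ⟶ M) : ℝ := ell L - ell (Ker f)

/-- A chain complex `0 → A₁ → A₂ → ⋯` of lattices, with `obj 0` the zero object at the left
end. -/
structure Complex : Type (u + 1) where
  obj : ℕ → EuclLat.{u}
  d : ∀ k, obj k ⟶ obj (k + 1)
  isZero : Limits.IsZero (obj 0)
  d_comp_d : ∀ k, d k ≫ d (k + 1) = 0

/-- The numerical cohomology of a chain complex. -/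
def Complex.hBullet (A : Complex.{u}) (k : ℕ) : ℝ := nul (A.d (k + 1)) - rk (A.d k)

/-! ### The canonical resolutions -/

/-- The lattice `ℤ` in `ℝ`. -/
abbrev Zlat : EuclLat.{0} where
  V := ℝ
  pts := Submodule.span ℤ {1}
  discrete := discrete_of_le_span (Module.Basis.singleton Unit ℝ) _
    (Submodule.span_mono (by simp))

/-- The lattice `P n` in `ℝ²` generated by `(1/n, 0)` and `(0, √(1/n² - 1/n⁴))`. -/
abbrev P (n : ℕ+) : EuclLat.{0} where
  V := EuclideanSpace ℝ (Fin 2)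
  pts := Submodule.span ℤ {!₂[1 / (n : ℝ), 0], !₂[0, √(1 / (n : ℝ) ^ 2 - 1 / (n : ℝ) ^ 4)]}
  discrete := by
    set c := √(1 / (n : ℝ) ^ 2 - 1 / (n : ℝ) ^ 4)
    have hn : (0 : ℝ) < n := by exact_mod_cast n.pos
    let w : Fin 2 → ℝˣ := ![Units.mk0 (1 / (n : ℝ)) (by positivity),
      if h : c = 0 then 1 else Units.mk0 c h]
    let b := (EuclideanSpace.basisFun (Fin 2) ℝ).toBasis.unitsSMul w
    refine discrete_of_le_span b _ (Submodule.span_le.2 ?_)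
    rintro x (rfl | rfl)
    · refine Submodule.subset_span ⟨0, ?_⟩
      ext i
      fin_cases i <;> simp [b, w, Module.Basis.unitsSMul_apply]
    · by_cases h : c = 0
      · have : (!₂[0, c] : EuclideanSpace ℝ (Fin 2)) = 0 := by
          ext i
          fin_cases i <;> simp [h]
        rw [this]
        exact Submodule.zero_mem _
      · refine Submodule.subset_span ⟨1, ?_⟩
        ext i
        fin_cases i <;> simp [b, w, h, Module.Basis.unitsSMul_apply]

/-- The image of `1` under the embedding of `ℤ` in `P n`. -/
def vec (n : ℕ+) : EuclideanSpace ℝ (Fin 2) := !₂[1 / (n : ℝ), √(1 - 1 / (n : ℝ) ^ 2)]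

lemma norm_vec (n : ℕ+) : ‖vec n‖ = 1 := by
  have hn : (1 : ℝ) ≤ n := by exact_mod_cast (one_le : (1 : ℕ+) ≤ n)
  have h : (1 / (n : ℝ)) ^ 2 ≤ 1 := by
    rw [div_pow, one_pow]; exact (div_le_one (by positivity)).2 (one_le_pow₀ hn)
  rw [EuclideanSpace.norm_eq]
  simp only [vec, Fin.sum_univ_two, Real.norm_eq_abs, sq_abs]
  rw [Real.sqrt_eq_one]
  simp
  rw [Real.sq_sqrt (by simpa using h)]
  ring

lemma sqrt_eq (n : ℕ+) : √(1 - 1 / (n : ℝ) ^ 2) = n * √(1 / (n : ℝ) ^ 2 - 1 / (n : ℝ) ^ 4) := by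
  have hn : (0 : ℝ) < n := by exact_mod_cast n.pos
  rw [← Real.sqrt_sq hn.le, ← Real.sqrt_mul (by positivity), Real.sqrt_sq hn.le]
  congr 1
  field_simp

lemma mem_P (n : ℕ+) (x : EuclideanSpace ℝ (Fin 2)) : x ∈ (P n).pts ↔
    ∃ a b : ℤ, a • !₂[1 / (n : ℝ), 0] + b • !₂[0, √(1 / (n : ℝ) ^ 2 - 1 / (n : ℝ) ^ 4)] = x :=
  Submodule.mem_span_pair

lemma vec_mem (n : ℕ+) : vec n ∈ (P n).pts := by
  rw [mem_P]
  refine ⟨1, n, ?_⟩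
  ext i
  fin_cases i
  · simp [vec]
  · simpa [vec] using (sqrt_eq n).symm

/-- The embedding of `ℤ` in `P n` which sends `1` to `(1/n, √(1 - 1/n²))`. -/
def emb (n : ℕ+) : Zlat ⟶ P n where
  map := (((LinearMap.toSpanSingleton ℝ _ (vec n)).restrictScalars ℤ).restrict (p := Zlat.pts)
    (q := (P n).pts) (by
      intro x hx
      obtain ⟨k, rfl⟩ := Submodule.mem_span_singleton.1 hx
      rw [map_smul]
      exact Submodule.smul_mem _ _ (by simpa using vec_mem n))).toAddMonoidHom
  norm_map_le x := by
    change ‖(x : ℝ) • vec n‖ ≤ ‖(x : ℝ)‖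
    rw [norm_smul, norm_vec, mul_one]

/-- The image of `ℤ` in `P n`. -/
def imZ (n : ℕ+) : Submodule ℤ (EuclideanSpace ℝ (Fin 2)) :=
  (LinearMap.range (emb n).map.toIntLinearMap).map (P n).pts.subtype

lemma isNormal_imZ (n : ℕ+) : (P n).IsNormal (imZ n) := by
  have hn : (0 : ℝ) < n := by exact_mod_cast n.pos
  refine ⟨Submodule.span ℝ {vec n}, ?_, ?_⟩
  · rw [Submodule.span_singleton_le_iff_mem]
    exact Submodule.subset_span (vec_mem n)
  ext x
  constructor
  · rintro ⟨_, ⟨⟨k, hk⟩, rfl⟩, rfl⟩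
    exact ⟨Subtype.property _, Submodule.mem_span_singleton.2 ⟨k, rfl⟩⟩
  · rintro ⟨h1, h2⟩
    obtain ⟨a, b, hab⟩ := (mem_P n x).1 h1
    obtain ⟨t, rfl⟩ := Submodule.mem_span_singleton.1 h2
    have e0 := congrArg (fun v : EuclideanSpace ℝ (Fin 2) => v 0) hab
    simp [vec] at e0
    have hta : t = a := by
      exact e0.symm
    refine ⟨(emb n).map ⟨(a : ℝ), Submodule.mem_span_singleton.2 ⟨a, by simp⟩⟩, ⟨_, rfl⟩, ?_⟩
    rw [hta]
    rfl

/-- The quotient lattice `P n / ℤ`. -/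
abbrev PmodZ (n : ℕ+) : EuclLat.{0} := (P n).quot (imZ n) (isNormal_imZ n)

/-- The objects of the chain complex `0 → P n ⊗ L → (P n / ℤ) ⊗ L → 0 → 0 → ⋯`. -/
def resObj (L : EuclLat.{u}) (n : ℕ+) : ℕ → EuclLat.{u}
  | 1 => tensor (P n) L
  | 2 => tensor (PmodZ n) L
  | _ => zeroLat

/-- The morphisms of the chain complex `0 → P n ⊗ L → (P n / ℤ) ⊗ L → 0 → 0 → ⋯`. -/
def resHom (L : EuclLat.{u}) (n : ℕ+) : ∀ k, resObj L n k ⟶ resObj L n (k + 1)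
  | 1 => tensorHom ((P n).quotHom (imZ n) (isNormal_imZ n)) L
  | 0 => 0
  | _ + 2 => 0

/-- The chain complex `0 → P n ⊗ L → (P n / ℤ) ⊗ L → 0 → 0 → ⋯`. -/
def res (L : EuclLat.{u}) (n : ℕ+) : Complex.{u} where
  obj := resObj L n
  d := resHom L n
  isZero := isZero_zeroLat
  d_comp_d
    | 0 => Limits.zero_comp
    | _ + 1 => Limits.comp_zero

/-! ### The cohomology and the Euler characteristic of lattices -/

/-- The cohomology of a lattice. -/
def h (k : ℕ) (L : EuclLat.{u}) : ℝ := limUnder atTop fun n : ℕ+ => (res L n).hBullet k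

/-- The Euler characteristic of a lattice. -/
def chi (L : EuclLat.{u}) : ℝ := ∑' k : ℕ, (-1) ^ k * h k L

end EuclLat
end

/-! Write θ(t) for the Gaussian mass of `L` scaled by t, and d for the dimension of `L`. For n ≥ 2
all the lattices in the complex have Gaussian masses expressible through θ. The generators of `P n`
are orthogonal, of lengths a = 1/n and b = `height n`, so `P n ⊗ L` is an orthogonal sum of two
scaled copies of `L` and has mass θ(a)θ(b). The quotient `P n / ℤ` is cyclic, generated by a vector
of length b/n = ab, so its tensor product with `L` has mass θ(ab). The kernel of the differential is
`vec n ⊗ L` (`Ker_tensorHom_quotZ`), a copy of `L` because `vec n` has length 1.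

Hence h⁰ is already constant for n ≥ 2, and the approximants of h¹ are ln ρ(L) + ln(θ(ab) /
(θ(a)θ(b))). The analytic input is `tendsto_theta`: t^d θ(t) → 1/vol(L) as t → 0⁺. In the quotient
the powers of a and b cancel, since (ab)^d = a^d b^d, and the limit is vol⁻¹ / vol⁻² = vol
(`tendsto_theta_quotient`).

The asymptotics are a Riemann sum argument. The integral of the step function y ↦ exp(-π‖t⌊y/t⌋‖²),
with ⌊·⌋ rounding to the lattice, equals t^d vol(L) θ(t). By dominated convergence it tends to ∫
exp(-π‖y‖²) = 1. Integrability of the same step function yields the convergence of the series. -/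

noncomputable section

/-! ### Gaussian sums over a lattice as integrals of step functions. -/

section Riemann

open MeasureTheory

variable {E : Type*} [NormedAddCommGroup E] [InnerProductSpace ℝ E] [FiniteDimensional ℝ E]
  [MeasurableSpace E] [BorelSpace E] {ι : Type*} [Fintype ι] (b : Module.Basis ι ℝ E)

lemma ZSpan.measurable_floor : Measurable fun x : E => (ZSpan.floor b x : E) := by
  have h : (fun x : E => (ZSpan.floor b x : E)) = fun x => ∑ i, (⌊b.repr x i⌋ : ℝ) • b i := by
    ext x
    conv_lhs => rw [← b.sum_repr (ZSpan.floor b x : E)]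
    simp
  rw [h]
  refine Finset.measurable_sum _ fun i _ => Measurable.smul_const ?_ _
  have : Measurable fun x : E => b.repr x i :=
    (LinearMap.continuous_of_finiteDimensional (b.coord i)).measurable
  exact (measurable_from_top (f := fun n : ℤ => (n : ℝ))).comp (Int.measurable_floor.comp this)

omit [FiniteDimensional ℝ E] [MeasurableSpace E] [BorelSpace E] in
lemma ZSpan.floor_vadd_of_mem (g : Submodule.span ℤ (Set.range b)) {x : E}
    (hx : x ∈ ZSpan.fundamentalDomain b) : (ZSpan.floor b ((g : E) + x) : E) = g := by
  have h1 := ZSpan.fract_apply b ((g : E) + x)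
  rw [ZSpan.fract_zSpan_add b x g.2, (ZSpan.fract_eq_self (b := b)).2 hx] at h1
  have h2 : (ZSpan.floor b ((g : E) + x) : E) = ((g : E) + x) - x := by
    nth_rewrite 3 [h1]
    abel
  rw [h2, add_sub_cancel_right]

lemma ZSpan.volume_fundamentalDomain_lt_top : volume (ZSpan.fundamentalDomain b) < ⊤ :=
  (ZSpan.fundamentalDomain_isBounded b).measure_lt_top

lemma ZSpan.isAddFundamentalDomain_volume : IsAddFundamentalDomain
    (Submodule.span ℤ (Set.range b)) (ZSpan.fundamentalDomain b) (volume : Measure E) :=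
  ZSpan.isAddFundamentalDomain b volume

instance : VAddInvariantMeasure (Submodule.span ℤ (Set.range b)) E (volume : Measure E) :=
  inferInstanceAs (VAddInvariantMeasure (Submodule.span ℤ (Set.range b)).toAddSubgroup E volume)

/-- The integral of a step function over the cells of a lattice. -/
lemma ZSpan.integral_comp_floor (f : E → ℝ) (hf : Integrable fun x => f (ZSpan.floor b x)) :
    ∫ x, f (ZSpan.floor b x) =
      volume.real (ZSpan.fundamentalDomain b) * ∑' g : Submodule.span ℤ (Set.range b), f g := by
  rw [(ZSpan.isAddFundamentalDomain_volume b).integral_eq_tsum'' _ hf, ← tsum_mul_left]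
  refine tsum_congr fun g => ?_
  rw [setIntegral_congr_fun (g := fun _ => f g) (ZSpan.fundamentalDomain_measurableSet b)]
  · simp
  · intro x hx
    exact congrArg f (ZSpan.floor_vadd_of_mem b g hx)

/-- Cutting the lower integral into translates of the cell needs no prior summability. The sum of
the values times the positive measure of the cell is then finite, so the sum itself is finite. -/
lemma ZSpan.summable_of_integrable (f : E → ℝ) (h0 : ∀ x, 0 ≤ f x)
    (hf : Integrable fun x => f (ZSpan.floor b x)) :
    Summable fun g : Submodule.span ℤ (Set.range b) => f g := by
  have h1 := (ZSpan.isAddFundamentalDomain_volume b).lintegral_eq_tsum''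
    (fun x => ENNReal.ofReal (f (ZSpan.floor b x)))
  have h2 : ∀ g : Submodule.span ℤ (Set.range b),
      ∫⁻ x in ZSpan.fundamentalDomain b, ENNReal.ofReal (f (ZSpan.floor b (g +ᵥ x))) =
        ENNReal.ofReal (f g) * volume (ZSpan.fundamentalDomain b) := by
    intro g
    rw [setLIntegral_congr_fun (g := fun _ => ENNReal.ofReal (f g))
      (ZSpan.fundamentalDomain_measurableSet b)]
    · simp
    · intro x hx
      exact congrArg (fun z => ENNReal.ofReal (f z)) (ZSpan.floor_vadd_of_mem b g hx)
  simp_rw [h2, ENNReal.tsum_mul_right] at h1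
  have h3 : ∑' g : Submodule.span ℤ (Set.range b), ENNReal.ofReal (f g) ≠ ⊤ := by
    intro h
    rw [h, ENNReal.top_mul (ZSpan.measure_fundamentalDomain_ne_zero b)] at h1
    exact hf.lintegral_lt_top.ne h1
  exact (ENNReal.summable_toReal h3).congr fun g => ENNReal.toReal_ofReal (h0 _)

/-- A non-integrable function has Bochner integral 0 by convention, whereas the known value of this
Gaussian integral is positive. -/
lemma integrable_exp_neg_mul_sq_norm {c : ℝ} (hc : 0 < c) :
    Integrable fun x : E => Real.exp (-c * ‖x‖ ^ 2) := by
  by_contra h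
  have h1 := GaussianFourier.integral_rexp_neg_mul_sq_norm (V := E) hc
  rw [integral_undef h] at h1
  have : 0 < (Real.pi / c) ^ (Module.finrank ℝ E / 2 : ℝ) := by positivity
  exact this.ne h1

omit [FiniteDimensional ℝ E] [MeasurableSpace E] [BorelSpace E] in
lemma norm_sub_smul_floor_le {t : ℝ} (ht : 0 < t) (y : E) :
    ‖t • (ZSpan.floor b (t⁻¹ • y) : E) - y‖ ≤ t * ∑ i, ‖b i‖ := by
  have h1 : t • (ZSpan.floor b (t⁻¹ • y) : E) - y = -(t • ZSpan.fract b (t⁻¹ • y)) := by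
    rw [ZSpan.fract_apply, smul_sub, smul_inv_smul₀ ht.ne']
    abel
  rw [h1, norm_neg, norm_smul, Real.norm_of_nonneg ht.le]
  exact mul_le_mul_of_nonneg_left (ZSpan.norm_fract_le b _) ht.le

omit [FiniteDimensional ℝ E] [MeasurableSpace E] [BorelSpace E] in
-- Rounding moves y by at most C = t ∑ ‖b i‖, so ‖y‖² ≤ 2‖z‖² + 2C² for the rounded point z. This
-- costs half of the exponent and a constant factor, but leaves an integrable Gaussian majorant.
lemma exp_smul_floor_le {t : ℝ} (ht : 0 < t) (y : E) :
    Real.exp (-Real.pi * ‖t • (ZSpan.floor b (t⁻¹ • y) : E)‖ ^ 2) ≤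
      Real.exp (Real.pi * (t * ∑ i, ‖b i‖) ^ 2) * Real.exp (-(Real.pi / 2) * ‖y‖ ^ 2) := by
  rw [← Real.exp_add]
  refine Real.exp_le_exp.2 ?_
  have h1 := norm_sub_smul_floor_le b ht y
  set z := t • (ZSpan.floor b (t⁻¹ • y) : E)
  set C := t * ∑ i, ‖b i‖
  have h2 : ‖y‖ ≤ ‖z‖ + C := by
    have : y = z - (z - y) := by abel
    calc ‖y‖ = ‖z - (z - y)‖ := by rw [← this]
      _ ≤ _ := (norm_sub_le _ _).trans (by gcongr)
  have h3 : ‖y‖ ^ 2 ≤ 2 * ‖z‖ ^ 2 + 2 * C ^ 2 := by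
    nlinarith [norm_nonneg y, sq_nonneg (‖z‖ - C)]
  nlinarith [Real.pi_pos]

lemma measurable_exp_smul_floor (t : ℝ) : Measurable fun y : E =>
    Real.exp (-Real.pi * ‖t • (ZSpan.floor b (t⁻¹ • y) : E)‖ ^ 2) := by
  have := (ZSpan.measurable_floor b).comp (measurable_const_smul (t⁻¹) (α := E))
  exact (((this.const_smul t).norm.pow_const 2).const_mul _).exp

lemma integrable_exp_smul_floor {t : ℝ} (ht : 0 < t) : Integrable fun y : E =>
    Real.exp (-Real.pi * ‖t • (ZSpan.floor b (t⁻¹ • y) : E)‖ ^ 2) := by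
  refine Integrable.mono' ((integrable_exp_neg_mul_sq_norm (E := E) (c := Real.pi / 2)
    (by positivity)).const_mul (Real.exp (Real.pi * (t * ∑ i, ‖b i‖) ^ 2)))
    (measurable_exp_smul_floor b t).aestronglyMeasurable (.of_forall fun y => ?_)
  rw [Real.norm_of_nonneg (Real.exp_nonneg _)]
  exact exp_smul_floor_le b ht y

lemma integrable_exp_floor {t : ℝ} (ht : 0 < t) : Integrable fun y : E =>
    Real.exp (-Real.pi * ‖t • (ZSpan.floor b y : E)‖ ^ 2) := by
  have := (integrable_exp_smul_floor b ht).comp_smul ht.ne'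
  simpa only [inv_smul_smul₀ ht.ne'] using this

lemma summable_exp_smul {t : ℝ} (ht : 0 < t) :
    Summable fun g : Submodule.span ℤ (Set.range b) =>
      Real.exp (-Real.pi * ‖t • (g : E)‖ ^ 2) :=
  ZSpan.summable_of_integrable b (fun x => Real.exp (-Real.pi * ‖t • x‖ ^ 2))
    (fun _ => Real.exp_nonneg _) (integrable_exp_floor b ht)

/-- The power of t is the Jacobian of y ↦ t⁻¹ • y; the remaining integral is a sum over unscaled
cells. -/
lemma integral_exp_smul_floor {t : ℝ} (ht : 0 < t) :
    ∫ y : E, Real.exp (-Real.pi * ‖t • (ZSpan.floor b (t⁻¹ • y) : E)‖ ^ 2) =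
      t ^ Module.finrank ℝ E * (volume.real (ZSpan.fundamentalDomain b) *
        ∑' g : Submodule.span ℤ (Set.range b), Real.exp (-Real.pi * ‖t • (g : E)‖ ^ 2)) := by
  rw [Measure.integral_comp_smul volume
    (fun x => Real.exp (-Real.pi * ‖t • (ZSpan.floor b x : E)‖ ^ 2)) t⁻¹, inv_pow, inv_inv,
    abs_of_pos (by positivity), smul_eq_mul]
  congr 1
  exact ZSpan.integral_comp_floor b (fun x => Real.exp (-Real.pi * ‖t • x‖ ^ 2))
    (integrable_exp_floor b ht)

/-- The asymptotics of the theta function of a lattice at zero. -/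
theorem tendsto_tsum_exp_smul :
    Tendsto (fun t : ℝ => t ^ Module.finrank ℝ E *
      ∑' g : Submodule.span ℤ (Set.range b), Real.exp (-Real.pi * ‖t • (g : E)‖ ^ 2))
      (𝓝[>] 0) (𝓝 (volume.real (ZSpan.fundamentalDomain b))⁻¹) := by
  have hv : volume.real (ZSpan.fundamentalDomain b) ≠ 0 :=
    (ENNReal.toReal_ne_zero).2 ⟨ZSpan.measure_fundamentalDomain_ne_zero b,
      (ZSpan.volume_fundamentalDomain_lt_top b).ne⟩
  -- The bound t ≤ 1 makes the majorant independent of t, as dominated convergence requires.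
  have h0 : ∀ᶠ t : ℝ in 𝓝[>] 0, 0 < t ∧ t ≤ 1 := by
    filter_upwards [Ioc_mem_nhdsGT (zero_lt_one (α := ℝ))] with t ht using ht
  have h1 : Tendsto (fun t : ℝ =>
      ∫ y : E, Real.exp (-Real.pi * ‖t • (ZSpan.floor b (t⁻¹ • y) : E)‖ ^ 2)) (𝓝[>] 0)
      (𝓝 (∫ y : E, Real.exp (-Real.pi * ‖y‖ ^ 2))) := by
    refine tendsto_integral_filter_of_dominated_convergence
      (fun y => Real.exp (Real.pi * (∑ i, ‖b i‖) ^ 2) * Real.exp (-(Real.pi / 2) * ‖y‖ ^ 2))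
      (.of_forall fun t => (measurable_exp_smul_floor b t).aestronglyMeasurable) ?_
      ((integrable_exp_neg_mul_sq_norm (by positivity)).const_mul _) (.of_forall fun y => ?_)
    · filter_upwards [h0] with t ht
      refine .of_forall fun y => ?_
      rw [Real.norm_of_nonneg (Real.exp_nonneg _)]
      refine (exp_smul_floor_le b ht.1 y).trans ?_
      have hS : 0 ≤ ∑ i, ‖b i‖ := Finset.sum_nonneg fun _ _ => norm_nonneg _
      have := mul_le_of_le_one_left hS ht.2
      have := mul_nonneg ht.1.le hS
      gcongr
    -- Pointwise convergence: the rounding error is O(t), so the rounded point tends to y.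
    · have hc : Continuous fun z : E => Real.exp (-Real.pi * ‖z‖ ^ 2) := by fun_prop
      refine (hc.tendsto y).comp (tendsto_iff_norm_sub_tendsto_zero.2 ?_)
      have h2 : Tendsto (fun t : ℝ => t * ∑ i, ‖b i‖) (𝓝[>] 0) (𝓝 0) := by
        have : Tendsto (fun t : ℝ => t * ∑ i, ‖b i‖) (𝓝 0) (𝓝 (0 * ∑ i, ‖b i‖)) :=
          tendsto_id.mul_const _
        rw [zero_mul] at this
        exact this.mono_left nhdsWithin_le_nhds
      refine squeeze_zero' (.of_forall fun _ => norm_nonneg _) ?_ h2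
      filter_upwards [h0] with t ht using norm_sub_smul_floor_le b ht.1 y
  -- With the normalisation π in the exponent, the Gaussian integral is 1 in every dimension.
  rw [GaussianFourier.integral_rexp_neg_mul_sq_norm Real.pi_pos, div_self Real.pi_ne_zero,
    Real.one_rpow] at h1
  have h2 := h1.const_mul (volume.real (ZSpan.fundamentalDomain b))⁻¹
  rw [mul_one] at h2
  refine h2.congr' ?_
  filter_upwards [h0] with t ht
  rw [integral_exp_smul_floor b ht.1]
  field_simp

end Riemann

/-! ### The theta function of a lattice and its volume. -/

namespace EuclLat

/-- The Gaussian mass of the lattice scaled by `t`. -/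
def theta (L : EuclLat.{u}) (t : ℝ) : ℝ :=
  ∑' x : L.pts, Real.exp (-Real.pi * (t * ‖(x : L.V)‖) ^ 2)

/-- The points of a lattice as points of the integral span of its real basis. -/
def equivSpan (L : EuclLat.{u}) : L.pts ≃ Submodule.span ℤ (Set.range L.rbasis) :=
  (Equiv.ofInjective L.incl fun x y h =>
    Subtype.ext (congrArg (fun z : L.span => (z : L.V)) h)).trans
    (Equiv.setCongr (by rw [span_rbasis]; rfl))

lemma exp_theta_eq (L : EuclLat.{u}) {t : ℝ} (ht : 0 < t) (x : L.pts) :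
    Real.exp (-Real.pi * ‖t • (L.equivSpan x : L.span)‖ ^ 2) =
      Real.exp (-Real.pi * (t * ‖(x : L.V)‖) ^ 2) := by
  rw [norm_smul, Real.norm_of_nonneg ht.le]
  rfl

lemma summable_theta (L : EuclLat.{u}) {t : ℝ} (ht : 0 < t) :
    Summable fun x : L.pts => Real.exp (-Real.pi * (t * ‖(x : L.V)‖) ^ 2) := by
  let _ : MeasurableSpace L.span := borel _
  have : BorelSpace L.span := ⟨rfl⟩
  refine ((L.equivSpan.summable_iff).2 (summable_exp_smul L.rbasis ht)).congr fun x => ?_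
  exact (L.exp_theta_eq ht x)

lemma theta_pos (L : EuclLat.{u}) {t : ℝ} (ht : 0 < t) : 0 < L.theta t :=
  (L.summable_theta ht).tsum_pos (fun _ => Real.exp_nonneg _) 0 (Real.exp_pos _)

lemma vol_eq_abs_det (L : EuclLat.{u}) :
    L.vol = |(stdOrthonormalBasis ℝ L.span).toBasis.det L.rbasis| := by
  rw [vol, ← LinearMap.det_toMatrix (stdOrthonormalBasis ℝ L.span).toBasis,
    Module.Basis.det_apply]
  congr 2
  ext i j
  simp [LinearMap.toMatrix_apply, volOp, Module.Basis.toMatrix_apply, rbasis_apply,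
    Module.Basis.constr_apply_fintype]

lemma vol_pos (L : EuclLat.{u}) : 0 < L.vol := by
  rw [vol_eq_abs_det, abs_pos]
  exact ((stdOrthonormalBasis ℝ L.span).toBasis.isUnit_det L.rbasis).ne_zero

/-- The half-open cell and the closed parallelepiped differ by a null set, and the volume of the
latter is the determinant in an orthonormal basis. -/
lemma vol_eq_volume (L : EuclLat.{u}) [MeasurableSpace L.span] [BorelSpace L.span] :
    L.vol = MeasureTheory.volume.real (ZSpan.fundamentalDomain L.rbasis) := by
  rw [ZSpan.measureReal_fundamentalDomain _ _ (stdOrthonormalBasis ℝ L.span).toBasis,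
    vol_eq_abs_det, MeasureTheory.measureReal_congr (ZSpan.fundamentalDomain_ae_parallelepiped _ _)]
  simp [MeasureTheory.measureReal_def, OrthonormalBasis.volume_parallelepiped]

lemma tendsto_theta (L : EuclLat.{u}) :
    Tendsto (fun t : ℝ => t ^ L.dim * L.theta t) (𝓝[>] 0) (𝓝 L.vol⁻¹) := by
  let _ : MeasurableSpace L.span := borel _
  have : BorelSpace L.span := ⟨rfl⟩
  rw [vol_eq_volume]
  refine (tendsto_tsum_exp_smul L.rbasis).congr' ?_
  filter_upwards [self_mem_nhdsWithin] with t ht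
  rw [theta, ← L.equivSpan.tsum_eq]
  simp_rw [L.exp_theta_eq ht]

end EuclLat
end

noncomputable section

/-! ### Tensors with orthogonal left factors. -/

section OrthogonalTensor

variable {V W : Type*} [NormedAddCommGroup V] [InnerProductSpace ℝ V] [NormedAddCommGroup W]
  [InnerProductSpace ℝ W] {ι : Type*} [Fintype ι]

/-- Pythagoras: inner products of pure tensors are products, so orthogonality of the left factors
alone kills the cross terms. -/
lemma norm_sum_tmul_sq {v : ι → V} (ho : Pairwise fun i j => inner ℝ (v i) (v j) = (0 : ℝ))
    (w : ι → W) : ‖∑ i, v i ⊗ₜ[ℝ] w i‖ ^ 2 = ∑ i, (‖v i‖ * ‖w i‖) ^ 2 := by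
  rw [← real_inner_self_eq_norm_sq, sum_inner]
  refine Finset.sum_congr rfl fun i _ => ?_
  rw [inner_sum, Finset.sum_eq_single i]
  · rw [real_inner_self_eq_norm_sq, TensorProduct.norm_tmul]
  · intro j _ hj
    rw [TensorProduct.inner_tmul, ho hj.symm, zero_mul]
  · simp

lemma eq_zero_of_sum_tmul_eq_zero {v : ι → V}
    (ho : Pairwise fun i j => inner ℝ (v i) (v j) = (0 : ℝ)) (h0 : ∀ i, v i ≠ 0) {w : ι → W}
    (h : ∑ i, v i ⊗ₜ[ℝ] w i = 0) (i : ι) : w i = 0 := by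
  have h1 := norm_sum_tmul_sq ho w
  rw [h, norm_zero, zero_pow two_ne_zero, eq_comm,
    Finset.sum_eq_zero_iff_of_nonneg fun _ _ => sq_nonneg _] at h1
  simpa [h0 i] using h1 i (Finset.mem_univ i)

end OrthogonalTensor

namespace EuclLat

/-! ### Gaussian masses of tensor products of lattices. -/

section Tensor

variable {M : EuclLat.{u}} {L : EuclLat.{v}} {ι : Type*} [Fintype ι]

/-- The tensor `∑ i, g i ⊗ x i`. -/
def tensorComb (L : EuclLat.{v}) (g : ι → M.pts) : (ι → L.pts) →ₗ[ℤ] M.span ⊗[ℝ] L.span where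
  toFun x := ∑ i, M.incl (g i) ⊗ₜ[ℝ] L.incl (x i)
  map_add' x y := by simp [TensorProduct.tmul_add, Finset.sum_add_distrib]
  map_smul' c x := by simp [Finset.smul_sum, TensorProduct.tmul_smul]

lemma tensorComb_apply (g : ι → M.pts) (x : ι → L.pts) :
    tensorComb L g x = ∑ i, M.incl (g i) ⊗ₜ[ℝ] L.incl (x i) := rfl

lemma tensorComb_zero (x : ι → L.pts) : tensorComb L (fun _ : ι => (0 : M.pts)) x = 0 := by
  simp [tensorComb_apply]

lemma tensorComb_mem (g : ι → M.pts) (x : ι → L.pts) :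
    tensorComb L g x ∈ (tensor M L).pts := by
  rw [tensorComb_apply]
  exact Submodule.sum_mem _ fun i _ => Submodule.subset_span (Set.mem_range_self (g i, x i))

/-- Integer coefficients of the left factor with respect to the generators can be moved to the right
factor. -/
lemma range_tensorComb (g : ι → M.pts) (hg : Submodule.span ℤ (Set.range g) = ⊤) :
    LinearMap.range (tensorComb L g) = (tensor M L).pts := by
  apply le_antisymm
  · rintro _ ⟨x, rfl⟩
    exact tensorComb_mem g x
  · refine Submodule.span_le.2 ?_
    rintro _ ⟨⟨m, y⟩, rfl⟩
    have hm : m ∈ Submodule.span ℤ (Set.range g) := hg ▸ Submodule.mem_top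
    obtain ⟨c, rfl⟩ := (Submodule.mem_span_range_iff_exists_fun ℤ).1 hm
    refine ⟨fun i => c i • y, ?_⟩
    simp only [tensorComb_apply, map_sum, map_smul, TensorProduct.sum_tmul]
    refine Finset.sum_congr rfl fun i _ => ?_
    rw [TensorProduct.tmul_smul, TensorProduct.smul_tmul']

lemma norm_tensorComb_sq (g : ι → M.pts)
    (ho : Pairwise fun i j => inner ℝ (g i : M.V) (g j : M.V) = 0) (x : ι → L.pts) :
    ‖tensorComb L g x‖ ^ 2 = ∑ i, (‖(g i : M.V)‖ * ‖(x i : L.V)‖) ^ 2 :=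
  norm_sum_tmul_sq (v := fun i => M.incl (g i)) ho fun i => L.incl (x i)

lemma tensorComb_injective (g : ι → M.pts)
    (ho : Pairwise fun i j => inner ℝ (g i : M.V) (g j : M.V) = 0) (h0 : ∀ i, (g i : M.V) ≠ 0) :
    Function.Injective (tensorComb L g) := by
  rw [injective_iff_map_eq_zero]
  intro x hx
  ext i
  have h1 : ∀ i, M.incl (g i) ≠ 0 := fun i h => h0 i (congrArg (fun z : M.span => (z : M.V)) h)
  exact congrArg (fun z : L.span => (z : L.V))
    (eq_zero_of_sum_tmul_eq_zero (v := fun i => M.incl (g i)) ho h1 hx i)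

lemma rho_range {V : Type*} [NormedAddCommGroup V] [InnerProductSpace ℝ V] {α : Type*}
    {φ : α → V} (hφ : Function.Injective φ) :
    rho (Set.range φ) = ∑' a, Real.exp (-Real.pi * ‖φ a‖ ^ 2) :=
  tsum_range (fun x => Real.exp (-Real.pi * ‖x‖ ^ 2)) hφ

lemma rho_range_tensorComb (g : ι → M.pts)
    (ho : Pairwise fun i j => inner ℝ (g i : M.V) (g j : M.V) = 0) (h0 : ∀ i, (g i : M.V) ≠ 0) :
    rho (LinearMap.range (tensorComb L g) : Set (M.span ⊗[ℝ] L.span)) =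
      ∑' x : ι → L.pts, Real.exp (-Real.pi * ∑ i, (‖(g i : M.V)‖ * ‖(x i : L.V)‖) ^ 2) := by
  rw [LinearMap.coe_range, rho_range (tensorComb_injective g ho h0)]
  simp_rw [norm_tensorComb_sq g ho]

lemma rho_range_tensorComb_single (g : M.pts) (h0 : (g : M.V) ≠ 0) :
    rho (LinearMap.range (tensorComb L fun _ : Unit => g) : Set (M.span ⊗[ℝ] L.span)) =
      L.theta ‖(g : M.V)‖ := by
  rw [rho_range_tensorComb _ (Subsingleton.pairwise) fun _ => h0,
    ← (Equiv.funUnique Unit L.pts).symm.tsum_eq]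
  simp [theta]

/-- The squared norm is a sum of one term per coordinate, so the exponential factors and the double
series is a product of two absolutely convergent ones. -/
lemma rho_range_tensorComb_pair (g : Fin 2 → M.pts)
    (ho : inner ℝ (g 0 : M.V) (g 1 : M.V) = (0 : ℝ)) (h0 : ∀ i, (g i : M.V) ≠ 0) :
    rho (LinearMap.range (tensorComb L g) : Set (M.span ⊗[ℝ] L.span)) =
      L.theta ‖(g 0 : M.V)‖ * L.theta ‖(g 1 : M.V)‖ := by
  have ho' : Pairwise fun i j => inner ℝ (g i : M.V) (g j : M.V) = (0 : ℝ) := by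
    intro i j hij
    fin_cases i <;> fin_cases j
    · exact absurd rfl hij
    · exact ho
    · exact (real_inner_comm _ _).trans ho
    · exact absurd rfl hij
  have h1 := L.summable_theta (norm_pos_iff.2 (h0 0))
  have h2 := L.summable_theta (norm_pos_iff.2 (h0 1))
  rw [rho_range_tensorComb g ho' h0, theta, theta, tsum_mul_tsum_of_summable_norm h1.norm h2.norm,
    ← (finTwoArrowEquiv L.pts).symm.tsum_eq]
  refine tsum_congr fun p => ?_
  rw [← Real.exp_add, ← mul_add, Fin.sum_univ_two]
  rfl

end Tensor

lemma coe_tensorHom_map {L M : EuclLat.{u}} (f : Hom L M) (N : EuclLat.{v})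
    (x : (tensor L N).pts) :
    ((tensorHom f N).map x : M.span ⊗[ℝ] N.span) = f.real.rTensor N.span x := rfl

lemma rTensor_real_tensorComb {L M : EuclLat.{u}} (f : Hom L M) (N : EuclLat.{v})
    {ι : Type*} [Fintype ι] (g : ι → L.pts) (x : ι → N.pts) :
    f.real.rTensor N.span (tensorComb N g x) = tensorComb N (fun i => f.map (g i)) x := by
  simp [tensorComb_apply, f.real_incl]

/-! ### The lattices `P n` and `P n / ℤ` -/

/-- The length of the second generator of `P n`. -/
def height (n : ℕ+) : ℝ := √(1 / (n : ℝ) ^ 2 - 1 / (n : ℝ) ^ 4)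

lemma height_nonneg (n : ℕ+) : 0 ≤ height n := Real.sqrt_nonneg _

lemma height_sq (n : ℕ+) : height n ^ 2 = 1 / (n : ℝ) ^ 2 - 1 / (n : ℝ) ^ 4 := by
  have hn : (1 : ℝ) ≤ n := by exact_mod_cast (one_le : (1 : ℕ+) ≤ n)
  refine Real.sq_sqrt (sub_nonneg.2 ?_)
  exact one_div_le_one_div_of_le (by positivity) (pow_le_pow_right₀ hn (by norm_num))

/-- At n = 1 the radicand vanishes and `P 1` degenerates to rank one; this is why n ≥ 2 is required
from here on. The limits do not see the excluded term. -/
lemma height_pos {n : ℕ+} (hn : 2 ≤ n) : 0 < height n := by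
  have hn : (2 : ℝ) ≤ n := by exact_mod_cast hn
  refine Real.sqrt_pos.2 (sub_pos.2 ?_)
  exact one_div_lt_one_div_of_lt (by positivity)
    (pow_lt_pow_right₀ (by linarith) (by norm_num))

/-- The generators of `P n`. -/
def gens (n : ℕ+) : Fin 2 → (P n).pts
  | 0 => ⟨!₂[1 / (n : ℝ), 0], Submodule.subset_span (by simp)⟩
  | 1 => ⟨!₂[0, height n], Submodule.subset_span (by simp [height])⟩

lemma coe_gens_zero (n : ℕ+) :
    (gens n 0 : EuclideanSpace ℝ (Fin 2)) = !₂[1 / (n : ℝ), 0] := rfl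

lemma coe_gens_one (n : ℕ+) :
    (gens n 1 : EuclideanSpace ℝ (Fin 2)) = !₂[0, height n] := rfl

lemma span_gens (n : ℕ+) : Submodule.span ℤ (Set.range (gens n)) = ⊤ := by
  rw [eq_top_iff]
  rintro ⟨x, hx⟩ -
  obtain ⟨a, b, rfl⟩ := (mem_P n x).1 hx
  rw [Submodule.mem_span_range_iff_exists_fun]
  exact ⟨![a, b], Subtype.ext (by simp [Fin.sum_univ_two, coe_gens_zero, coe_gens_one, height])⟩

lemma norm_gens_zero (n : ℕ+) : ‖(gens n 0 : EuclideanSpace ℝ (Fin 2))‖ = 1 / (n : ℝ) := by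
  rw [coe_gens_zero, EuclideanSpace.norm_eq]
  simp

lemma norm_gens_one (n : ℕ+) : ‖(gens n 1 : EuclideanSpace ℝ (Fin 2))‖ = height n := by
  rw [coe_gens_one, EuclideanSpace.norm_eq]
  simpa using Real.sqrt_sq (height_nonneg n)

lemma inner_gens (n : ℕ+) : inner ℝ (gens n 0 : EuclideanSpace ℝ (Fin 2)) (gens n 1) = (0 : ℝ) := by
  simp [coe_gens_zero, coe_gens_one, PiLp.inner_apply]

lemma gens_ne_zero {n : ℕ+} (hn : 2 ≤ n) (i : Fin 2) :
    (gens n i : EuclideanSpace ℝ (Fin 2)) ≠ 0 := by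
  rw [← norm_pos_iff]
  fin_cases i
  · exact (norm_gens_zero n).symm ▸ (by positivity)
  · exact (norm_gens_one n).symm ▸ height_pos hn

/-- The image of `1` under the embedding of `ℤ` in `P n`, as a lattice point. -/
def vecPt (n : ℕ+) : (P n).pts := ⟨vec n, vec_mem n⟩

lemma vecPt_eq (n : ℕ+) : vecPt n = gens n 0 + (n : ℤ) • gens n 1 := by
  apply Subtype.ext
  change vec n = !₂[1 / (n : ℝ), 0] + (n : ℤ) • !₂[0, height n]
  ext i
  fin_cases i
  · simp [vec]
  · simpa [vec, height] using sqrt_eq n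

lemma span_imZ (n : ℕ+) :
    Submodule.span ℝ (imZ n : Set (EuclideanSpace ℝ (Fin 2))) = Submodule.span ℝ {vec n} := by
  apply le_antisymm
  · refine Submodule.span_le.2 ?_
    rintro _ ⟨_, ⟨k, rfl⟩, rfl⟩
    exact Submodule.mem_span_singleton.2 ⟨k, rfl⟩
  · rw [Submodule.span_singleton_le_iff_mem]
    refine Submodule.subset_span ⟨_, ⟨⟨1, Submodule.mem_span_singleton_self 1⟩, rfl⟩, ?_⟩
    exact one_smul ℝ (vec n)

lemma proj_imZ (n : ℕ+) (x : EuclideanSpace ℝ (Fin 2)) :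
    proj (imZ n) x = x - inner ℝ (vec n) x • vec n := by
  simp only [proj, span_imZ]
  rw [Submodule.starProjection_orthogonal_val,
    Submodule.starProjection_unit_singleton ℝ (norm_vec n)]

/-- The projection of `P n` to `P n / ℤ`. -/
abbrev quotZ (n : ℕ+) : Hom (P n) (PmodZ n) := (P n).quotHom (imZ n) (isNormal_imZ n)

lemma coe_quotZ_map (n : ℕ+) (x : (P n).pts) :
    ((quotZ n).map x : EuclideanSpace ℝ (Fin 2)) = proj (imZ n) x := rfl

lemma quotZ_map_vecPt (n : ℕ+) : (quotZ n).map (vecPt n) = 0 := by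
  apply Subtype.ext
  rw [coe_quotZ_map, proj_imZ]
  change vec n - inner ℝ (vec n) (vec n) • vec n = 0
  rw [real_inner_self_eq_norm_sq, norm_vec]
  simp

/-- The relation comes from projecting `vec n`, the first generator plus n times the second, to
zero. It makes the quotient cyclic, generated by the image of the second generator. -/
lemma quotZ_map_gens_zero (n : ℕ+) :
    (quotZ n).map (gens n 0) = -((n : ℤ) • (quotZ n).map (gens n 1)) := by
  have h := quotZ_map_vecPt n
  rw [vecPt_eq, map_add, map_zsmul] at h
  exact eq_neg_of_add_eq_zero_left h

lemma norm_quotZ_map_gens_one (n : ℕ+) :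
    ‖((quotZ n).map (gens n 1) : EuclideanSpace ℝ (Fin 2))‖ = height n / n := by
  have hn : (0 : ℝ) < n := by exact_mod_cast n.pos
  have hi : inner ℝ (vec n) (gens n 1 : EuclideanSpace ℝ (Fin 2)) = n * height n ^ 2 := by
    have : vec n = !₂[1 / (n : ℝ), n * height n] := by rw [vec, sqrt_eq]; rfl
    rw [this, coe_gens_one]
    simp [PiLp.inner_apply]
    ring
  rw [← sq_eq_sq₀ (norm_nonneg _) (div_nonneg (height_nonneg n) hn.le), coe_quotZ_map, proj_imZ,
    hi, norm_sub_sq_real, real_inner_smul_right, real_inner_comm, hi, norm_smul, norm_vec,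
    norm_gens_one, mul_one, Real.norm_eq_abs, sq_abs]
  -- With b = `height n`, the projection has squared length b² - (n b²)² = b² (1 - n² b²), and this
  -- identity turns the bracket into 1/n².
  have h1 : (n : ℝ) ^ 2 * height n ^ 2 = 1 - 1 / (n : ℝ) ^ 2 := by
    rw [height_sq]
    field_simp
  rw [div_pow]
  linear_combination (-(height n ^ 2)) * h1

lemma quotZ_map_gens_one_ne_zero {n : ℕ+} (hn : 2 ≤ n) :
    ((quotZ n).map (gens n 1) : EuclideanSpace ℝ (Fin 2)) ≠ 0 := by
  have h0 : (0 : ℝ) < n := by exact_mod_cast n.pos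
  rw [← norm_pos_iff, norm_quotZ_map_gens_one]
  exact div_pos (height_pos hn) h0

lemma span_quotZ_map_gens_one (n : ℕ+) :
    Submodule.span ℤ (Set.range fun _ : Unit => (quotZ n).map (gens n 1)) = ⊤ := by
  rw [eq_top_iff, Set.range_const]
  rintro ⟨_, x, hx, rfl⟩ -
  have h1 : (⟨x, hx⟩ : (P n).pts) ∈ Submodule.span ℤ (Set.range (gens n)) :=
    (span_gens n).symm ▸ Submodule.mem_top
  obtain ⟨c, hc⟩ := (Submodule.mem_span_range_iff_exists_fun ℤ).1 h1
  have h2 : (quotZ n).map ⟨x, hx⟩ ∈ Submodule.span ℤ {(quotZ n).map (gens n 1)} := by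
    rw [← hc, Fin.sum_univ_two, map_add, map_zsmul, map_zsmul, quotZ_map_gens_zero]
    have h3 := Submodule.mem_span_singleton_self (R := ℤ) ((quotZ n).map (gens n 1))
    exact Submodule.add_mem _ (Submodule.smul_mem _ _ (Submodule.neg_mem _
      (Submodule.smul_mem _ _ h3))) (Submodule.smul_mem _ _ h3)
  exact h2

/-- Let g₀, g₁ be the generators and q the image of g₁. The tensor g₀ ⊗ x₀ + g₁ ⊗ x₁ maps to q ⊗ (x₁
- n x₀). As q ≠ 0, it vanishes only if x₁ = n x₀, and then the tensor is (g₀ + n g₁) ⊗ x₀ = `vec n`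
⊗ x₀. -/
lemma Ker_tensorHom_quotZ (L : EuclLat.{u}) {n : ℕ+} (hn : 2 ≤ n) :
    (Ker (tensorHom (quotZ n) L)).pts =
      LinearMap.range (tensorComb L fun _ : Unit => vecPt n) := by
  ext z
  rw [mem_Ker]
  constructor
  · rintro ⟨hz, h⟩
    have hz' := hz
    rw [← range_tensorComb (L := L) (gens n) (span_gens n)] at hz'
    obtain ⟨x, rfl⟩ := hz'
    have h1 : tensorComb L (fun i => (quotZ n).map (gens n i)) x = 0 := by
      rw [← rTensor_real_tensorComb]
      exact congrArg (fun y : (tensor (PmodZ n) L).pts => (y : (PmodZ n).span ⊗[ℝ] L.span)) h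
    have h2 : tensorComb L (fun _ : Unit => (quotZ n).map (gens n 1))
        (fun _ => x 1 - (n : ℤ) • x 0) = 0 := by
      rw [← h1, tensorComb_apply, tensorComb_apply, Fin.sum_univ_two, quotZ_map_gens_zero]
      simp only [Finset.univ_unique, Finset.sum_const, Finset.card_singleton, one_smul, map_sub,
        map_smul, map_neg, TensorProduct.tmul_sub, TensorProduct.neg_tmul,
        TensorProduct.tmul_smul, TensorProduct.smul_tmul']
      abel
    have h3 := (injective_iff_map_eq_zero _).1
      (tensorComb_injective (L := L) (fun _ : Unit => (quotZ n).map (gens n 1))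
        Subsingleton.pairwise fun _ => quotZ_map_gens_one_ne_zero hn) _ h2
    have h4 : x 1 = (n : ℤ) • x 0 := sub_eq_zero.1 (congrFun h3 ())
    refine ⟨fun _ => x 0, ?_⟩
    rw [tensorComb_apply, tensorComb_apply, Fin.sum_univ_two, h4, vecPt_eq]
    simp only [Finset.univ_unique, Finset.sum_const, Finset.card_singleton, one_smul, map_add,
      map_smul, TensorProduct.add_tmul, TensorProduct.tmul_smul, TensorProduct.smul_tmul']
  · rintro ⟨x, rfl⟩
    have hz := tensorComb_mem (fun _ : Unit => vecPt n) x
    refine ⟨hz, Subtype.ext ?_⟩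
    rw [coe_tensorHom_map]
    have h : (fun _ : Unit => (quotZ n).map (vecPt n)) = fun _ => 0 :=
      funext fun _ => quotZ_map_vecPt n
    exact (rTensor_real_tensorComb (quotZ n) L (fun _ : Unit => vecPt n) x).trans
      ((congrArg (fun g => tensorComb L g x) h).trans (tensorComb_zero x))

lemma theta_one (L : EuclLat.{u}) : L.theta 1 = rho (L.pts : Set L.V) := by
  simp only [theta, one_mul]
  rfl

lemma ell_Ker_tensorHom_quotZ (L : EuclLat.{u}) {n : ℕ+} (hn : 2 ≤ n) :
    ell (Ker (tensorHom (quotZ n) L)) = Real.log (rho (L.pts : Set L.V)) := by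
  have h0 : ‖(vecPt n : EuclideanSpace ℝ (Fin 2))‖ = 1 := norm_vec n
  have h1 : (vecPt n : EuclideanSpace ℝ (Fin 2)) ≠ 0 := by
    rw [← norm_pos_iff, h0]
    exact one_pos
  rw [ell, Ker_tensorHom_quotZ L hn, rho_range_tensorComb_single _ h1, h0, theta_one]

lemma ell_tensor_P (L : EuclLat.{u}) {n : ℕ+} (hn : 2 ≤ n) :
    ell (tensor (P n) L) = Real.log (L.theta (1 / n) * L.theta (height n)) := by
  rw [ell, ← range_tensorComb (gens n) (span_gens n),
    rho_range_tensorComb_pair _ (inner_gens n) (gens_ne_zero hn), norm_gens_zero, norm_gens_one]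

lemma ell_tensor_PmodZ (L : EuclLat.{u}) {n : ℕ+} (hn : 2 ≤ n) :
    ell (tensor (PmodZ n) L) = Real.log (L.theta (height n / n)) := by
  rw [ell, ← range_tensorComb _ (span_quotZ_map_gens_one n),
    rho_range_tensorComb_single _ (quotZ_map_gens_one_ne_zero hn), norm_quotZ_map_gens_one]

/-! ### The numerical cohomology of the resolutions -/

lemma ell_of_subsingleton (L : EuclLat.{u}) [Subsingleton L.pts] : ell L = 0 := by
  have : Unique L.pts := Unique.mk' _
  have h : rho (L.pts : Set L.V) = 1 := by
    have h0 : ((default : L.pts) : L.V) = 0 :=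
      congrArg Subtype.val (Subsingleton.elim (default : L.pts) 0)
    refine (tsum_eq_single (β := L.pts) default
      fun x hx => (hx (Subsingleton.elim _ _)).elim).trans ?_
    rw [h0]
    simp
  rw [ell, h, Real.log_one]

lemma Ker_zero {L M : EuclLat.{u}} : (Ker (0 : L ⟶ M)).pts = L.pts := by
  ext x
  rw [mem_Ker]
  exact ⟨fun h => h.1, fun h => ⟨h, rfl⟩⟩

lemma nul_zero (L M : EuclLat.{u}) : nul (0 : L ⟶ M) = ell L := by
  rw [nul, ell, ell, Ker_zero]

lemma rk_zero (L M : EuclLat.{u}) : rk (0 : L ⟶ M) = 0 :=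
  sub_eq_zero.2 (nul_zero L M).symm

lemma ell_zeroLat : ell zeroLat.{u} = 0 := ell_of_subsingleton _

lemma hBullet_zero (L : EuclLat.{u}) {n : ℕ+} (hn : 2 ≤ n) :
    (res L n).hBullet 0 = Real.log (rho (L.pts : Set L.V)) := by
  have h : (res L n).hBullet 0 = ell (Ker (tensorHom (quotZ n) L)) -
    rk (0 : zeroLat.{u} ⟶ tensor (P n) L) := rfl
  rw [h, rk_zero, sub_zero, ell_Ker_tensorHom_quotZ L hn]

/-- The outgoing differential is zero, so its nullity is `ell` of the whole second term; the
incoming one has as kernel a copy of `L`, which contributes ln ρ(L). -/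
lemma hBullet_one (L : EuclLat.{u}) {n : ℕ+} (hn : 2 ≤ n) :
    (res L n).hBullet 1 = Real.log (rho (L.pts : Set L.V)) +
      Real.log (L.theta (height n / n) / (L.theta (1 / n) * L.theta (height n))) := by
  have h0 : (0 : ℝ) < n := by exact_mod_cast n.pos
  have hh := height_pos hn
  have h : (res L n).hBullet 1 = nul (0 : tensor (PmodZ n) L ⟶ zeroLat.{u}) -
    (ell (tensor (P n) L) - ell (Ker (tensorHom (quotZ n) L))) := rfl
  rw [h, nul_zero, ell_tensor_PmodZ L hn, ell_tensor_P L hn, ell_Ker_tensorHom_quotZ L hn,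
    Real.log_div (L.theta_pos (by positivity)).ne'
      (mul_pos (L.theta_pos (by positivity)) (L.theta_pos hh)).ne']
  ring

lemma hBullet_add_two (L : EuclLat.{u}) (n : ℕ+) (k : ℕ) : (res L n).hBullet (k + 2) = 0 := by
  -- Degree 2 is separate because its incoming map starts at `(P n / ℤ) ⊗ L` rather than at the zero
  -- lattice.
  cases k with
  | zero =>
    have h : (res L n).hBullet 2 = nul (0 : zeroLat.{u} ⟶ zeroLat.{u}) -
      rk (0 : tensor (PmodZ n) L ⟶ zeroLat.{u}) := rfl
    rw [zero_add, h, nul_zero, rk_zero, ell_zeroLat, sub_zero]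
  | succ k =>
    have h : (res L n).hBullet (k + 1 + 2) = nul (0 : zeroLat.{u} ⟶ zeroLat.{u}) -
      rk (0 : zeroLat.{u} ⟶ zeroLat.{u}) := rfl
    rw [h, nul_zero, rk_zero, ell_zeroLat, sub_zero]

/-! ### Limits as n tends to infinity. -/

lemma tendsto_PNat_val : Tendsto (fun n : ℕ+ => (n : ℝ)) atTop atTop :=
  tendsto_natCast_atTop_atTop.comp tendsto_PNat_val_atTop_atTop

lemma tendsto_one_div : Tendsto (fun n : ℕ+ => 1 / (n : ℝ)) atTop (𝓝[>] 0) := by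
  refine tendsto_nhdsWithin_iff.2 ⟨?_, .of_forall fun n => ?_⟩
  · simp_rw [one_div]
    exact tendsto_inv_atTop_zero.comp tendsto_PNat_val
  · have h0 : (0 : ℝ) < n := by exact_mod_cast n.pos
    exact one_div_pos.2 h0

lemma height_le (n : ℕ+) : height n ≤ 1 / n := by
  have h0 : (0 : ℝ) < n := by exact_mod_cast n.pos
  rw [← sq_le_sq₀ (height_nonneg n) (by positivity), height_sq, div_pow, one_pow]
  exact sub_le_self _ (by positivity)

lemma eventually_two_le : ∀ᶠ n : ℕ+ in atTop, 2 ≤ n := eventually_ge_atTop 2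

lemma tendsto_height : Tendsto height atTop (𝓝[>] 0) := by
  refine tendsto_nhdsWithin_iff.2 ⟨?_, ?_⟩
  · exact squeeze_zero height_nonneg height_le
      (tendsto_nhdsWithin_iff.1 tendsto_one_div).1
  · filter_upwards [eventually_two_le] with n hn using height_pos hn

lemma tendsto_height_div : Tendsto (fun n : ℕ+ => height n / n) atTop (𝓝[>] 0) := by
  refine tendsto_nhdsWithin_iff.2 ⟨?_, ?_⟩
  · simp_rw [div_eq_mul_one_div (height _)]
    simpa using (tendsto_nhdsWithin_iff.1 tendsto_height).1.mul
      (tendsto_nhdsWithin_iff.1 tendsto_one_div).1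
  · filter_upwards [eventually_two_le] with n hn
    have h0 : (0 : ℝ) < n := by exact_mod_cast n.pos
    exact div_pos (height_pos hn) h0

/-- The length `height n / n` is the product of the two generator lengths, so normalising all three
theta values by the `L.dim`-th powers of their arguments leaves the quotient unchanged. -/
lemma tendsto_theta_quotient (L : EuclLat.{u}) : Tendsto (fun n : ℕ+ =>
    L.theta (height n / n) / (L.theta (1 / n) * L.theta (height n))) atTop (𝓝 L.vol) := by
  have hv := L.vol_pos.ne'
  have h1 := (L.tendsto_theta.comp tendsto_height_div).div
    ((L.tendsto_theta.comp tendsto_one_div).mul (L.tendsto_theta.comp tendsto_height))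
    (mul_ne_zero (inv_ne_zero hv) (inv_ne_zero hv))
  have h2 : L.vol⁻¹ / (L.vol⁻¹ * L.vol⁻¹) = L.vol := by field_simp
  rw [h2] at h1
  refine h1.congr' ?_
  filter_upwards [eventually_two_le] with n hn
  have h0 : (0 : ℝ) < n := by exact_mod_cast n.pos
  have hh := height_pos hn
  have h3 : (height n / n) ^ L.dim = (1 / (n : ℝ)) ^ L.dim * height n ^ L.dim := by
    rw [← mul_pow]
    congr 1
    ring
  simp only [Function.comp_apply, Pi.div_apply]
  rw [h3, mul_mul_mul_comm, mul_div_mul_left _ _ (by positivity)]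

lemma tendsto_hBullet_zero (L : EuclLat.{u}) : Tendsto (fun n : ℕ+ => (res L n).hBullet 0) atTop
    (𝓝 (Real.log (rho (L.pts : Set L.V)))) :=
  tendsto_const_nhds.congr' (eventually_two_le.mono fun _ hn => (hBullet_zero L hn).symm)

lemma tendsto_hBullet_one (L : EuclLat.{u}) : Tendsto (fun n : ℕ+ => (res L n).hBullet 1) atTop
    (𝓝 (Real.log (rho (L.pts : Set L.V)) + Real.log L.vol)) :=
  ((L.tendsto_theta_quotient.log L.vol_pos.ne').const_add _).congr'
    (eventually_two_le.mono fun _ hn => (hBullet_one L hn).symm)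

lemma tendsto_hBullet_add_two (L : EuclLat.{u}) (k : ℕ) :
    Tendsto (fun n : ℕ+ => (res L n).hBullet (k + 2)) atTop (𝓝 0) := by
  simp_rw [hBullet_add_two]
  exact tendsto_const_nhds

lemma h_zero (L : EuclLat.{u}) : h 0 L = Real.log (rho (L.pts : Set L.V)) :=
  L.tendsto_hBullet_zero.limUnder_eq

lemma h_one (L : EuclLat.{u}) : h 1 L = Real.log (rho (L.pts : Set L.V)) + Real.log L.vol :=
  L.tendsto_hBullet_one.limUnder_eq

lemma h_add_two (L : EuclLat.{u}) (k : ℕ) : h (k + 2) L = 0 :=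
  (L.tendsto_hBullet_add_two k).limUnder_eq

lemma chi_eq (L : EuclLat.{u}) : L.chi = -Real.log L.vol := by
  -- Only degrees 0 and 1 survive, and their ln ρ(L) terms cancel.
  rw [chi, tsum_eq_sum (s := Finset.range 2), Finset.sum_range_succ, Finset.sum_range_one, h_zero,
    h_one]
  · ring
  · intro k hk
    obtain ⟨j, rfl⟩ := Nat.exists_eq_add_of_le' (not_lt.1 fun h => hk (Finset.mem_range.2 h))
    rw [h_add_two, mul_zero]

end EuclLat
end

theorem mainTheorem2 (L : EuclLat.{u}) :
    Summable (fun x : L.pts => Real.exp (-Real.pi * ‖(x : L.V)‖ ^ 2)) ∧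
    0 < L.vol ∧
    (∀ k : ℕ, Tendsto (fun n : ℕ+ => (L.res n).hBullet k) atTop (𝓝 (EuclLat.h k L))) ∧
    EuclLat.h 0 L = Real.log (EuclLat.rho (L.pts : Set L.V)) ∧
    EuclLat.h 1 L = Real.log (EuclLat.rho (L.pts : Set L.V)) + Real.log L.vol ∧
    (∀ k : ℕ, 2 ≤ k → EuclLat.h k L = 0) ∧
    L.chi = -Real.log L.vol := by
  refine ⟨by simpa only [one_mul] using L.summable_theta one_pos, L.vol_pos, ?_, L.h_zero, L.h_one,
    ?_, L.chi_eq⟩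
  · rintro (_ | _ | k)
    · exact L.h_zero ▸ L.tendsto_hBullet_zero
    · exact L.h_one ▸ L.tendsto_hBullet_one
    · exact L.h_add_two k ▸ L.tendsto_hBullet_add_two k
  · intro k hk
    obtain ⟨j, rfl⟩ := Nat.exists_eq_add_of_le' hk
    exact L.h_add_two j
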